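/- Let $G$ be a finite simple graph with vertex set $V$; write $u\simeq v$ if $u,v$ are adjacent or equal, $[t]=\{1,\dots,t\}$, and $J$ for the all-ones matrix, so that $\langle J,X\rangle$ is the sum of the entries of $X$. For a finite set $I$ let $\mathcal{DNN}^I$ be the cone of positive semidefinite real symmetric $I\times I$ matrices with nonnegative entries, and let $\mathcal{CP}^I$ be the cone of Gram matrices of families $(x_i)_{i\in I}$ of entrywise nonnegative vectors $x_i\in\mathbb R^d_+$, for some $d$. Let $\alpha(G)$ be the stability number of $G$ and $$\vartheta'(G)=\max\{\langle J,X\rangle : X\in\mathcal{DNN}^{V},\ \operatorname{Tr}X=1,\ X_{uv}=0 \text{ for all } \{u,v\}\in E(G)\}$$ (with $\vartheta'(G)=0$ if $V=\emptyset$). For $t\in\mathbb N$ and a real matrix $X$ indexed by $\{0\}\cup (V\times[t])$ consider the conditions - (C1) $X_{0,0}=1$; - (C2a) $\sum_{u\in V}X_{0,ui}=1$ for all $i\in[t]$; - (C2b) $\sum_{u,v\in V}X_{ui,vi}=1$ for all $i\in[t]$; - (O1) $X_{ui,vj}=0$ for all $i\neq j$ in $[t]$ and all $u\simeq v$ in $V$;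 - (O2) $X_{ui,vi}=0$ for all $i\in[t]$ and all $u\ne v$ in $V$. Then: 1. The largest $t\in\mathbb N$ for which some $X\in\mathcal{DNN}^{\{0\}\cup (V\times[t])}$ satisfies (C1), (C2a), (C2b), (O1), (O2) exists and equals $\lfloor\vartheta'(G)\rfloor$; the same holds if (O2) is dropped. If $V\neq\emptyset$, the maximum defining $\vartheta'(G)$ is attained. 2. The largest $t\in\mathbb N$ for which some $X\in\mathcal{CP}^{\{0\}\cup (V\times[t])}$ satisfies (C1), (C2a), (C2b), (O1), (O2) exists and equals $\alpha(G)$; the same holds if (O2) is dropped. 3. For $\mathcal K\in\{\mathcal{DNN},\mathcal{CP}\}$ and every integer $t\ge1$ the following are equivalent: (i) there is $X\in\mathcal K^{V}$ with $\lfloor\langle J,X\rangle\rfloor=t$, $\operatorname{Tr}X=1$ and $X_{uv}=0$ for all $\{u,v\}\in E(G)$; (ii) there is $X\in\mathcal K^{\{0\}\cup (V\times[t])}$ satisfying (C1), (C2a), (C2b), (O1), (O2); (iii) there is $X\in\mathcal K^{\{0\}\cup (V\times[t])}$ satisfying (C1), (C2a), (C2b), (O1). 4. For every integer $t\ge1$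 with $\vartheta'(G)\ge t$ one has $\vartheta'(G_t)\ge t$, where $G_t$ is the graph on $V\times[t]$ in which distinct $(u,i)$ and $(v,j)$ are adjacent if $i\ne j$ and $u\simeq v$, or if $i=j$ and $u\neq v$. -/

import Mathlib

universe u

/-- The doubly nonnegative cone: positive semidefinite (in particular symmetric) real matrices
with nonnegative entries, rows and columns indexed by `ι`. -/
def DNN (ι : Type u) : Set (Matrix ι ι ℝ) :=
  {X | X.PosSemidef ∧ ∀ i j, 0 ≤ X i j}

/-- The completely positive cone: Gram matrices of nonnegative vectors of some `ℝ^d`.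
(Allowing `d = 0` adds nothing: it gives the zero matrix, which is also obtained with `d = 1`.) -/
def CP (ι : Type u) : Set (Matrix ι ι ℝ) :=
  {X | ∃ (d : ℕ) (x : ι → Fin d → ℝ), (∀ i k, 0 ≤ x i k) ∧ ∀ i j, X i j = ∑ k, x i k * x j k}

/-- A matrix cone `K`, given for every index set (`DNN` and `CP` are the instances of interest). -/
abbrev ConeFamily := (ι : Type u) → Set (Matrix ι ι ℝ)

section Graph

variable {V : Type u} [Fintype V]

/-- The trace inner product `⟨J, X⟩` with the all-ones matrix: the sum of all entries of `X`. -/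
def innerJ (X : Matrix V V ℝ) : ℝ := ∑ u, ∑ v, X u v

/-- Feasibility for the theta program over the cone `K`: `X ∈ K`, `Tr X = 1`, and `X` vanishes on
the edges of `G`. -/
structure ThetaFeasible (K : ConeFamily.{u}) (G : SimpleGraph V) (X : Matrix V V ℝ) : Prop where
  mem : X ∈ K V
  trace_eq : X.trace = 1
  edge : ∀ u v, G.Adj u v → X u v = 0

/-- The objective values `⟨J, X⟩` attained in the theta program over `K`. -/
def thetaValues (K : ConeFamily.{u}) (G : SimpleGraph V) : Set ℝ :=
  {s | ∃ X, ThetaFeasible K G X ∧ innerJ X = s}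

/-- Schrijver's number `ϑ'(G)`: the optimum of the theta program over the doubly nonnegative cone.
(On the graph without vertices the program is infeasible, and the value is `0`.) -/
noncomputable def thetaPrime (G : SimpleGraph V) : ℝ := sSup (thetaValues DNN G)

/-- The graph `G_t` on `V × [t]`: distinct `(u, i)`, `(v, j)` are adjacent if `i ≠ j` and `u, v` are
equal or adjacent in `G`, or if `i = j` and `u ≠ v`. -/
def graphG (G : SimpleGraph V) (t : ℕ) : SimpleGraph (V × Fin t) where
  Adj p q := (p.2 ≠ q.2 ∧ (p.1 = q.1 ∨ G.Adj p.1 q.1)) ∨ (p.2 = q.2 ∧ p.1 ≠ q.1)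
  symm := ⟨by
    rintro p q (⟨h, h' | h'⟩ | ⟨h, h'⟩)
    · exact Or.inl ⟨h.symm, Or.inl h'.symm⟩
    · exact Or.inl ⟨h.symm, Or.inr h'.symm⟩
    · exact Or.inr ⟨h.symm, h'.symm⟩⟩
  loopless := ⟨by
    rintro p (⟨h, -⟩ | ⟨-, h⟩) <;> exact h rfl⟩

/-- The linear conditions of the program for `α*`, on a matrix indexed by `{0} ∪ V × [t]`: the
normalization C1, the sum conditions C2a and C2b, and the orthogonality condition O1. The index `0`
is `none`, and the index `ui` is `some (u, i)`. -/
structure StabConditions (G : SimpleGraph V) (t : ℕ)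
    (X : Matrix (Option (V × Fin t)) (Option (V × Fin t)) ℝ) : Prop where
  C1 : X none none = 1
  C2a : ∀ i, ∑ u, X none (some (u, i)) = 1
  C2b : ∀ i, ∑ u, ∑ v, X (some (u, i)) (some (v, i)) = 1
  O1 : ∀ i j, i ≠ j → ∀ u v, (u = v ∨ G.Adj u v) → X (some (u, i)) (some (v, j)) = 0

/-- The additional orthogonality condition O2 of the program for `α_q`. -/
def StabO2 (V : Type u) (t : ℕ)
    (X : Matrix (Option (V × Fin t)) (Option (V × Fin t)) ℝ) : Prop :=
  ∀ i, ∀ u v, u ≠ v → X (some (u, i)) (some (v, i)) = 0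

/-- The conic program of `α*` with the cone replaced by `K` is feasible for `t`. -/
def FeasibleWithoutO2 (K : ConeFamily.{u}) (G : SimpleGraph V) (t : ℕ) : Prop :=
  ∃ X ∈ K (Option (V × Fin t)), StabConditions G t X

/-- The conic program of `α_q` with the cone replaced by `K` is feasible for `t`. -/
def FeasibleWithO2 (K : ConeFamily.{u}) (G : SimpleGraph V) (t : ℕ) : Prop :=
  ∃ X ∈ K (Option (V × Fin t)), StabConditions G t X ∧ StabO2 V t X

end Graph

/-! For `CP` everything reduces to stable sequences. Splitting a Gram representation into
coordinates, each coordinate has stable support, so Cauchy–Schwarz bounds the theta objective by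
`G.indepNum`. In the bordered program a coordinate where the vector of index 0 is nonzero selects
one vertex for each `i`, and O1 makes these a stable sequence. Rank-one indicator matrices give the
converses.

For `DNN`, let P be the sum of the diagonal blocks of a feasible Y and Q the sum of all blocks. Then
t⁻¹(Q + Diag(P1) − P) is theta feasible: adding the Laplacian Diag(P1) − P moves the off-diagonal
mass inside blocks to the diagonal, so O2 is not needed, and the objective stays at least t.
Conversely, take an optimal X with s = ϑ'(G). Optimality under diagonal scaling forces row sums
s·X_uu. With D = Diag(X_uu) and B = (X − D)/(s − 1), the matrix with diagonal blocks D and all other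
blocks B, bordered by the diagonal of X, is feasible for 2 ≤ t ≤ s. Decomposing along constants in
[t] and their complement leaves D + (t−1)B, a nonnegative combination of D and X, and the Laplacian
D − B. -/

open Finset

/-! ### Positive semidefiniteness and the two cones. -/

section Cones

variable {n : Type*} [Fintype n]

theorem posSemidef_real_iff {M : Matrix n n ℝ} :
    M.PosSemidef ↔ (∀ i j, M i j = M j i) ∧ ∀ x : n → ℝ, 0 ≤ ∑ i, ∑ j, x i * M i j * x j := by
  have key : ∀ x : n → ℝ, star x ⬝ᵥ M.mulVec x = ∑ i, ∑ j, x i * M i j * x j := fun x => by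
    simp only [dotProduct, Matrix.mulVec, Pi.star_apply, star_trivial, mul_sum, mul_assoc]
  rw [Matrix.posSemidef_iff_dotProduct_mulVec]
  simp only [key]
  refine and_congr_left fun _ => ?_
  exact ⟨fun h i j => (h.apply i j).symm, fun h => Matrix.IsHermitian.ext fun i j => (h i j).symm⟩

/-- This is the Laplacian of a weighted graph: its quadratic form is ½ ∑ B_ij (x_i − x_j)². -/
theorem posSemidef_diagonal_rowSum_sub [DecidableEq n] {B : Matrix n n ℝ}
    (hs : ∀ i j, B i j = B j i) (hB : ∀ i j, 0 ≤ B i j) :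
    (Matrix.diagonal (fun i => ∑ j, B i j) - B).PosSemidef := by
  rw [posSemidef_real_iff]
  refine ⟨fun i j => ?_, fun x => ?_⟩
  · rcases eq_or_ne i j with rfl | h
    · rfl
    · simp [Matrix.diagonal_apply_ne _ h, Matrix.diagonal_apply_ne _ h.symm, hs i j]
  · have h1 : ∑ i, ∑ j, x i * (Matrix.diagonal (fun i => ∑ j, B i j) - B) i j * x j
        = ∑ i, ∑ j, (x i ^ 2 * B i j - x i * B i j * x j) := by
      refine sum_congr rfl fun i _ => ?_
      simp only [Matrix.sub_apply, mul_sub, sub_mul, sum_sub_distrib]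
      congr 1
      rw [sum_eq_single i (fun j _ h => by simp [Matrix.diagonal_apply_ne _ h.symm])
        (by simp), Matrix.diagonal_apply_eq, ← mul_sum]
      ring
    have h2 : ∑ i, ∑ j, x i ^ 2 * B i j = ∑ i, ∑ j, x j ^ 2 * B i j := by
      rw [sum_comm]
      exact sum_congr rfl fun i _ => sum_congr rfl fun j _ => by rw [hs]
    have h3 : 2 * ∑ i, ∑ j, (x i ^ 2 * B i j - x i * B i j * x j)
        = ∑ i, ∑ j, B i j * (x i - x j) ^ 2 := by
      have : ∑ i, ∑ j, B i j * (x i - x j) ^ 2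
          = ∑ i, ∑ j, x i ^ 2 * B i j + ∑ i, ∑ j, x j ^ 2 * B i j
            - 2 * ∑ i, ∑ j, x i * B i j * x j := by
        simp only [mul_sum, ← sum_add_distrib, ← sum_sub_distrib]
        exact sum_congr rfl fun i _ => sum_congr rfl fun j _ => by ring
      rw [this, ← h2]
      simp only [sum_sub_distrib]
      ring
    have h4 : 0 ≤ ∑ i, ∑ j, B i j * (x i - x j) ^ 2 :=
      sum_nonneg fun i _ => sum_nonneg fun j _ => mul_nonneg (hB i j) (sq_nonneg _)
    rw [h1]
    linarith

theorem posSemidef_congr_sum {m : Type*} [Fintype m] {M : Matrix m m ℝ} (hM : M.PosSemidef)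
    (R : m → n → ℝ) :
    (Matrix.of fun a b => ∑ u, ∑ v, R u a * M u v * R v b).PosSemidef := by
  have := hM.conjTranspose_mul_mul_same (Matrix.of R)
  convert this using 1
  ext a b
  simp only [Matrix.of_apply, Matrix.mul_apply, Matrix.conjTranspose_apply, star_trivial, sum_mul]
  exact sum_comm

theorem two_mul_apply_le_of_posSemidef {M : Matrix n n ℝ} (hM : M.PosSemidef) (i j : n) :
    2 * M i j ≤ M i i + M j j := by
  classical
  rcases eq_or_ne i j with rfl | h
  · linarith
  have h0 := (posSemidef_real_iff.1 (hM.submatrix ![i, j])).2 ![1, -1]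
  have hs := (posSemidef_real_iff.1 hM).1 i j
  simp [Fin.sum_univ_two] at h0
  linarith

theorem CP_subset_DNN (ι : Type u) [Finite ι] : CP ι ⊆ DNN ι := by
  rintro X ⟨d, x, hx, hX⟩
  refine ⟨?_, fun i j => ?_⟩
  · convert Matrix.posSemidef_self_mul_conjTranspose (Matrix.of x) using 1
    ext i j
    simp [Matrix.mul_apply, hX]
  · rw [hX]
    exact sum_nonneg fun k _ => mul_nonneg (hx _ _) (hx _ _)

theorem convex_DNN (ι : Type u) : Convex ℝ (DNN ι) := fun _ hX _ hY _ _ ha hb _ =>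
  ⟨(hX.1.smul ha).add (hY.1.smul hb), fun i j =>
    add_nonneg (mul_nonneg ha (hX.2 i j)) (mul_nonneg hb (hY.2 i j))⟩

end Cones

/-! ### Stable sequences and the completely positive programs. -/

section Stable

variable {V : Type u} [Fintype V] {G : SimpleGraph V} {t : ℕ}

/-- A stable sequence: `t` pairwise distinct and pairwise nonadjacent vertices. -/
def IsStableSeq (G : SimpleGraph V) (s : Fin t → V) : Prop :=
  ∀ i j, i ≠ j → s i ≠ s j ∧ ¬ G.Adj (s i) (s j)

theorem exists_isStableSeq_iff : (∃ s : Fin t → V, IsStableSeq G s) ↔ t ≤ G.indepNum := by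
  classical
  constructor
  · rintro ⟨s, hs⟩
    have hinj : Function.Injective s := fun i j h => by
      by_contra hne
      exact (hs i j hne).1 h
    have : G.IsIndepSet (univ.image s : Finset V) := by
      intro a ha b hb hab
      simp only [coe_image, coe_univ, Set.image_univ, Set.mem_range] at ha hb
      obtain ⟨i, rfl⟩ := ha
      obtain ⟨j, rfl⟩ := hb
      exact (hs i j fun h => hab (h ▸ rfl)).2
    simpa [card_image_of_injective _ hinj] using this.card_le_indepNum
  · intro h
    obtain ⟨S, hS⟩ := G.exists_isNIndepSet_indepNum
    have hc : t ≤ S.card := hS.card_eq ▸ h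
    refine ⟨fun i => S.equivFin.symm (Fin.castLE hc i), fun i j hij => ?_⟩
    have hne : ((S.equivFin.symm (Fin.castLE hc i) : S) : V) ≠ S.equivFin.symm (Fin.castLE hc j) := by
      intro h
      exact hij (Fin.castLE_injective hc (S.equivFin.symm.injective (Subtype.ext h)))
    exact ⟨hne, hS.isIndepSet (Subtype.coe_prop _) (Subtype.coe_prop _) hne⟩

/-- Each coordinate of the Gram vectors is supported on a stable set, since nonnegative terms
summing to zero on an edge all vanish. Cauchy–Schwarz on that support costs at most a factor
`G.indepNum`. -/
theorem innerJ_le_indepNum {X : Matrix V V ℝ} (hX : ThetaFeasible CP G X) :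
    innerJ X ≤ G.indepNum := by
  classical
  obtain ⟨⟨d, x, hx, hX'⟩, htr, hE⟩ := hX
  have h1 : innerJ X = ∑ k, (∑ u, x u k) ^ 2 := by
    simp only [innerJ, hX', pow_two, sum_mul_sum]
    rw [sum_comm (s := univ (α := Fin d))]
    exact sum_congr rfl fun u _ => sum_comm
  have h2 : (1 : ℝ) = ∑ k, ∑ u, x u k ^ 2 := by
    rw [← htr, Matrix.trace, sum_comm]
    simp only [Matrix.diag_apply, hX', pow_two]
  have h3 : ∀ k, (∑ u, x u k) ^ 2 ≤ G.indepNum * ∑ u, x u k ^ 2 := by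
    intro k
    let S : Finset V := univ.filter fun u => x u k ≠ 0
    have hS : G.IsIndepSet S := by
      intro u hu v hv _ hadj
      have hu' : x u k ≠ 0 := by simpa [S] using hu
      have hv' : x v k ≠ 0 := by simpa [S] using hv
      have h0 := hE u v hadj
      rw [hX', sum_eq_zero_iff_of_nonneg fun k _ => mul_nonneg (hx _ _) (hx _ _)] at h0
      exact mul_ne_zero hu' hv' (h0 k (mem_univ _))
    have e1 : ∑ u, x u k = ∑ u ∈ S, x u k := by rw [sum_filter_ne_zero]
    calc (∑ u, x u k) ^ 2 = (∑ u ∈ S, x u k) ^ 2 := by rw [e1]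
      _ ≤ S.card * ∑ u ∈ S, x u k ^ 2 := sq_sum_le_card_mul_sum_sq
      _ ≤ G.indepNum * ∑ u, x u k ^ 2 := by
        gcongr
        · exact hS.card_le_indepNum
        · exact subset_univ S
  calc innerJ X ≤ ∑ k, G.indepNum * ∑ u, x u k ^ 2 := h1 ▸ sum_le_sum fun k _ => h3 k
    _ = G.indepNum := by rw [← mul_sum, ← h2, mul_one]

theorem IsStableSeq.exists_thetaFeasible_CP {s : Fin t → V} (hs : IsStableSeq G s) (ht : 1 ≤ t) :
    ∃ X : Matrix V V ℝ, ThetaFeasible CP G X ∧ innerJ X = t := by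
  classical
  have ht' : (t : ℝ) ≠ 0 := by positivity
  let x : V → ℝ := fun u => ∑ i, if u = s i then 1 else 0
  have hx0 : ∀ u, 0 ≤ x u := fun u => sum_nonneg fun i _ => by split_ifs <;> norm_num
  have hxs : ∑ u, x u = t := by
    simp only [x]
    rw [sum_comm]
    simp
  have hxx : ∀ u v, x u * x v = ∑ i, ∑ j, if u = s i ∧ v = s j then 1 else 0 := fun u v => by
    simp only [x, sum_mul_sum, ite_and, mul_ite, mul_one, mul_zero]
    refine sum_congr rfl fun i _ => sum_congr rfl fun j _ => ?_
    split_ifs <;> rfl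
  -- A stable sequence is injective, so `x` is a 0/1 indicator.
  have hsq : ∀ u, x u * x u = x u := fun u => by
    rw [hxx]
    refine sum_congr rfl fun i _ => ?_
    rw [sum_eq_single i]
    · simp
    · rintro j - hj
      rw [if_neg]
      rintro ⟨h1, h2⟩
      exact (hs j i hj).1 (h2 ▸ h1)
    · simp
  refine ⟨Matrix.of fun u v => (t : ℝ)⁻¹ * (x u * x v), ⟨⟨1, fun u _ => √(t : ℝ)⁻¹ * x u, ?_, ?_⟩, ?_, ?_⟩, ?_⟩
  · exact fun u _ => mul_nonneg (Real.sqrt_nonneg _) (hx0 u)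
  · intro u v
    have := Real.mul_self_sqrt (show (0 : ℝ) ≤ (t : ℝ)⁻¹ by positivity)
    simp only [univ_unique, sum_const, card_singleton, one_smul, Matrix.of_apply]
    rw [mul_mul_mul_comm, this]
  · simp only [Matrix.trace, Matrix.diag_apply, Matrix.of_apply, hsq]
    rw [← mul_sum, hxs, inv_mul_cancel₀ ht']
  · intro u v huv
    rw [Matrix.of_apply, hxx, sum_eq_zero, mul_zero]
    refine fun i _ => sum_eq_zero fun j _ => ?_
    rw [if_neg]
    rintro ⟨rfl, rfl⟩
    by_cases hij : i = j
    · exact huv.ne (hij ▸ rfl)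
    · exact (hs i j hij).2 huv
  · simp only [innerJ, Matrix.of_apply, ← mul_sum, hxs, ← sum_mul]
    field_simp

theorem IsStableSeq.feasibleWithO2_CP {s : Fin t → V} (hs : IsStableSeq G s) :
    FeasibleWithO2 CP G t := by
  classical
  let y : Option (V × Fin t) → ℝ := fun a => a.elim 1 fun p => if p.1 = s p.2 then 1 else 0
  refine ⟨Matrix.of fun a b => y a * y b, ⟨1, fun a _ => y a, ?_, fun a b => by simp⟩,
    ⟨by simp [y], fun i => by simp [y], fun i => by simp [y], ?_⟩, ?_⟩
  · rintro (_ | p) _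
    · simp [y]
    · simp only [y, Option.elim]
      split_ifs <;> norm_num
  · intro i j hij u v huv
    by_contra h
    simp only [y, Matrix.of_apply, Option.elim, mul_eq_zero, ite_eq_right_iff, one_ne_zero, imp_false, not_or,
      not_not] at h
    obtain ⟨rfl, rfl⟩ := h
    exact huv.elim (hs i j hij).1 (hs i j hij).2
  · intro i u v huv
    by_contra h
    simp only [y, Matrix.of_apply, Option.elim, mul_eq_zero, ite_eq_right_iff, one_ne_zero, imp_false, not_or,
      not_not] at h
    exact huv (h.1.trans h.2.symm)

/-- By C1, C2a and C2b, the vector of index 0 and each sum over u of the vectors of index ui are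
unit vectors with inner product 1, hence equal. A coordinate nonzero in the former is therefore
nonzero at some ui for every i. -/
theorem exists_isStableSeq_of_feasibleWithoutO2_CP (h : FeasibleWithoutO2 CP G t) :
    ∃ s : Fin t → V, IsStableSeq G s := by
  obtain ⟨Y, ⟨d, y, hy, hY⟩, hC1, hC2a, hC2b, hO1⟩ := h
  have hk : ∃ k, y none k ≠ 0 := by
    by_contra! h0
    rw [hY, sum_eq_zero fun k _ => by rw [h0, mul_zero]] at hC1
    exact zero_ne_one hC1
  obtain ⟨k, hk⟩ := hk
  have hsum : ∀ i, ∑ u, y (some (u, i)) k = y none k := by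
    intro i
    have h0 : ∑ k, (y none k - ∑ u, y (some (u, i)) k) ^ 2 = 0 := by
      have e1 : ∑ k, y none k * y none k = 1 := by rw [← hY, hC1]
      have e2 : ∑ k, y none k * ∑ u, y (some (u, i)) k = 1 := by
        rw [← hC2a i]
        simp only [hY, mul_sum]
        rw [sum_comm]
      have e3 : ∑ k, (∑ u, y (some (u, i)) k) * ∑ u, y (some (u, i)) k = 1 := by
        rw [← hC2b i]
        simp only [hY, sum_mul_sum]
        rw [sum_comm]
        exact sum_congr rfl fun u _ => sum_comm
      have : ∀ k, (y none k - ∑ u, y (some (u, i)) k) ^ 2 = y none k * y none k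
          - 2 * (y none k * ∑ u, y (some (u, i)) k)
          + (∑ u, y (some (u, i)) k) * ∑ u, y (some (u, i)) k := fun k => by ring
      simp only [this, sum_add_distrib, sum_sub_distrib, ← mul_sum, e1, e2, e3]
      norm_num
    rw [sum_eq_zero_iff_of_nonneg fun k _ => sq_nonneg _] at h0
    have := pow_eq_zero_iff (two_ne_zero) |>.1 (h0 k (mem_univ _))
    linarith
  have hex : ∀ i, ∃ u, y (some (u, i)) k ≠ 0 := by
    intro i
    by_contra! h0
    exact hk (by rw [← hsum i, sum_eq_zero fun u _ => h0 u])
  choose s hs using hex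
  refine ⟨s, fun i j hij => ?_⟩
  have : ¬ (s i = s j ∨ G.Adj (s i) (s j)) := fun hc => by
    have h0 := hO1 i j hij _ _ hc
    rw [hY, sum_eq_zero_iff_of_nonneg fun k _ => mul_nonneg (hy _ _) (hy _ _)] at h0
    exact mul_ne_zero (hs i) (hs j) (h0 k (mem_univ _))
  exact not_or.1 this

end Stable

/-! ### Attainment and optimality for ϑ', and the doubly nonnegative programs. -/

section DoublyNonnegative

variable {V : Type u} [Fintype V] {G : SimpleGraph V} {t : ℕ}

theorem ThetaFeasible.apply_mem_Icc {X : Matrix V V ℝ} (hX : ThetaFeasible DNN G X) (u v : V) :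
    X u v ∈ Set.Icc (0 : ℝ) 1 := by
  have hd : ∀ w, X w w ≤ 1 := fun w => by
    rw [← hX.trace_eq]
    exact single_le_sum (f := fun w => X w w) (fun w _ => hX.mem.2 w w) (mem_univ w)
  have := two_mul_apply_le_of_posSemidef hX.mem.1 u v
  exact ⟨hX.mem.2 u v, by linarith [hd u, hd v]⟩

theorem isCompact_thetaFeasible_DNN (G : SimpleGraph V) :
    IsCompact {X : Matrix V V ℝ | ThetaFeasible DNN G X} := by
  have hK : IsCompact (X := Matrix V V ℝ)
      (Set.univ.pi fun _ => Set.univ.pi fun _ => Set.Icc (0 : ℝ) 1) :=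
    isCompact_univ_pi (X := fun _ : V => V → ℝ) fun _ =>
      isCompact_univ_pi (X := fun _ : V => ℝ) fun _ => isCompact_Icc
  have hent : ∀ u v, Continuous fun X : Matrix V V ℝ => X u v := fun u v =>
    continuous_id.matrix_elem u v
  refine hK.of_isClosed_subset ?_ fun X hX u _ v _ => hX.apply_mem_Icc u v
  have heq : {X : Matrix V V ℝ | ThetaFeasible DNN G X} =
      {X | ((∀ u v, X u v = X v u) ∧ ∀ x : V → ℝ, 0 ≤ ∑ u, ∑ v, x u * X u v * x v) ∧
        (∀ u v, 0 ≤ X u v) ∧ ∑ u, X u u = 1 ∧ ∀ u v, G.Adj u v → X u v = 0} := by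
    ext X
    refine ⟨fun h => ⟨posSemidef_real_iff.1 h.mem.1, h.mem.2, h.trace_eq, h.edge⟩,
      fun h => ⟨⟨posSemidef_real_iff.2 h.1, h.2.1⟩, h.2.2.1, h.2.2.2⟩⟩
  rw [heq]
  simp only [Set.ofPred_and, Set.ofPred_forall]
  refine (IsClosed.inter ?_ ?_).inter (IsClosed.inter ?_ (IsClosed.inter ?_ ?_))
  · exact isClosed_iInter fun u => isClosed_iInter fun v => isClosed_eq (hent u v) (hent v u)
  · exact isClosed_iInter fun x => isClosed_le continuous_const <|
      continuous_finsetSum _ fun u _ => continuous_finsetSum _ fun v _ =>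
        (continuous_const.mul (hent u v)).mul continuous_const
  · exact isClosed_iInter fun u => isClosed_iInter fun v => isClosed_le continuous_const (hent u v)
  · exact isClosed_eq (continuous_finsetSum _ fun u _ => hent u u) continuous_const
  · exact isClosed_iInter fun u => isClosed_iInter fun v => isClosed_iInter fun _ =>
      isClosed_eq (hent u v) continuous_const

theorem isCompact_thetaValues_DNN (G : SimpleGraph V) : IsCompact (thetaValues DNN G) := by
  have hc : Continuous (innerJ : Matrix V V ℝ → ℝ) :=
    continuous_finsetSum _ fun u _ => continuous_finsetSum _ fun v _ =>
      continuous_id.matrix_elem u v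
  exact (isCompact_thetaFeasible_DNN G).image hc

theorem ThetaFeasible.innerJ_le_thetaPrime {X : Matrix V V ℝ} (hX : ThetaFeasible DNN G X) :
    innerJ X ≤ thetaPrime G :=
  le_csSup (isCompact_thetaValues_DNN G).bddAbove ⟨X, hX, rfl⟩

theorem exists_thetaFeasible_innerJ_eq_one [Nonempty V] (G : SimpleGraph V) :
    ∃ X : Matrix V V ℝ, ThetaFeasible DNN G X ∧ innerJ X = 1 := by
  have hs : IsStableSeq G fun _ : Fin 1 => Classical.arbitrary V := fun i j hij =>
    (hij (Subsingleton.elim i j)).elim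
  obtain ⟨X, hX, h1⟩ := hs.exists_thetaFeasible_CP le_rfl
  exact ⟨X, ⟨CP_subset_DNN V hX.mem, hX.trace_eq, hX.edge⟩, by simpa using h1⟩

theorem isGreatest_thetaPrime [Nonempty V] (G : SimpleGraph V) :
    IsGreatest (thetaValues DNN G) (thetaPrime G) :=
  (isCompact_thetaValues_DNN G).isGreatest_sSup
    (let ⟨X, hX, _⟩ := exists_thetaFeasible_innerJ_eq_one G; ⟨innerJ X, X, hX, rfl⟩)

theorem thetaPrime_eq_zero [IsEmpty V] (G : SimpleGraph V) : thetaPrime G = 0 := by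
  have : thetaValues DNN G = ∅ := by
    ext s
    simp only [thetaValues, Set.mem_ofPred_eq, Set.mem_empty_iff_false, iff_false]
    rintro ⟨X, hX, -⟩
    have := hX.trace_eq
    simp [Matrix.trace] at this
  rw [thetaPrime, this, Real.sSup_empty]

/-- First order optimality under diagonal scaling: in an optimal solution every row sum is the
optimal value times the diagonal entry. -/
theorem ThetaFeasible.rowSum_eq {X : Matrix V V ℝ} (hX : ThetaFeasible DNN G X)
    (hmax : innerJ X = thetaPrime G) (w : V) :
    ∑ v, X w v = thetaPrime G * X w w := by
  classical
  set s := thetaPrime G with hs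
  have hsym := (posSemidef_real_iff.1 hX.mem.1).1
  have hXw := hX.apply_mem_Icc w w
  -- Scale row and column `w` of X by 1 + ε, renormalize the trace, and compare the objective with
  -- the optimum.
  have key : ∀ ε : ℝ, |ε| < 1 →
      ε * (2 * (∑ v, X w v - s * X w w)) ≤ ε ^ 2 * ((s - 1) * X w w) := by
    intro ε hε
    obtain ⟨hε1, hε2⟩ := abs_lt.1 hε
    let z : V → ℝ := fun u => 1 + if u = w then ε else 0
    have hz : ∀ u, 0 ≤ z u := fun u => by
      simp only [z]
      split_ifs <;> linarith
    have htr : ∑ u, z u * X u u * z u = 1 + (2 * ε + ε ^ 2) * X w w := by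
      have : ∀ u, z u * X u u * z u
          = X u u + if u = w then (2 * ε + ε ^ 2) * X u u else 0 := fun u => by
        simp only [z]
        split_ifs <;> ring
      simp only [this, sum_add_distrib, sum_ite_eq', mem_univ, if_true]
      congr 1
      exact hX.trace_eq
    have hin : ∑ u, ∑ v, z u * X u v * z v
        = s + 2 * ε * ∑ v, X w v + ε ^ 2 * X w w := by
      have : ∀ u v, z u * X u v * z v = X u v + (if u = w then ε * X u v else 0)
          + (if v = w then ε * X u v else 0)
          + (if u = w then (if v = w then ε ^ 2 * X u v else 0) else 0) := fun u v => by
        simp only [z]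
        split_ifs <;> ring
      simp only [this, sum_add_distrib, sum_ite_eq', mem_univ, if_true]
      have e1 : ∑ u, ∑ v, X u v = s := hmax
      have e2 : ∑ u, ∑ v, (if u = w then ε * X u v else 0) = ε * ∑ v, X w v := by
        rw [sum_comm]
        simp [mul_sum]
      have e3 : ∑ u, ε * X u w = ε * ∑ v, X w v := by
        rw [← mul_sum]
        simp only [hsym _ w]
      have e4 : ∑ u, ∑ v, (if u = w then (if v = w then ε ^ 2 * X u v else 0) else 0)
          = ε ^ 2 * X w w := by
        rw [sum_comm]
        simp
      rw [e1, e2, e3, e4]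
      ring
    have hpos : 0 < 1 + (2 * ε + ε ^ 2) * X w w := by
      nlinarith [hXw.1, hXw.2, sq_nonneg (ε + 1), mul_nonneg hXw.1 (sq_nonneg (ε + 1)),
        pow_pos (show 0 < 1 + ε by linarith) 2]
    set τ := 1 + (2 * ε + ε ^ 2) * X w w with hτ
    have hfeas : ThetaFeasible DNN G (τ⁻¹ • Matrix.of fun u v => z u * X u v * z v) := by
      refine ⟨⟨Matrix.PosSemidef.smul ?_ (inv_nonneg.2 hpos.le), fun u v => ?_⟩, ?_, ?_⟩
      · convert posSemidef_congr_sum hX.mem.1 fun u v => if u = v then z u else 0 using 1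
        ext u v
        simp
      · exact mul_nonneg (inv_nonneg.2 hpos.le)
          (mul_nonneg (mul_nonneg (hz u) (hX.mem.2 u v)) (hz v))
      · rw [Matrix.trace_smul, Matrix.trace]
        simp only [Matrix.diag_apply, Matrix.of_apply, htr, smul_eq_mul]
        exact inv_mul_cancel₀ hpos.ne'
      · intro u v huv
        simp [hX.edge u v huv]
    have hle := hfeas.innerJ_le_thetaPrime
    simp only [innerJ, Matrix.smul_apply, Matrix.of_apply, smul_eq_mul, ← mul_sum, hin] at hle
    rw [inv_mul_le_iff₀ hpos, ← hs] at hle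
    rw [hτ] at hle
    nlinarith
  set a := 2 * (∑ v, X w v - s * X w w) with ha
  set c := (s - 1) * X w w
  suffices a = 0 by linarith
  by_contra hne
  have hN : 0 < |a| + |c| + 1 := by positivity
  -- With this ε, small and of the sign of `a`, the inequality of `key` becomes |a| + |c| + 1 ≤ c,
  -- which is absurd.
  have h1 := key (a / (|a| + |c| + 1)) (by
    rw [abs_div, abs_of_pos hN, div_lt_one hN]
    linarith [abs_nonneg c])
  have hsq : 0 < a ^ 2 := by positivity
  have h2 : a / (|a| + |c| + 1) * a = a ^ 2 / (|a| + |c| + 1) ^ 2 * (|a| + |c| + 1) := by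
    field_simp
  rw [h2, div_pow] at h1
  have h3 := le_of_mul_le_mul_left h1 (by positivity)
  linarith [le_abs_self c, abs_nonneg a]

/-- By O1, Q and P agree on the diagonal and on edges, so Q − P + Diag(P1) vanishes on edges and has
trace ∑ P = t. Laplacians have entry sum zero, so its entry sum is ∑ Q ≥ t². -/
theorem exists_thetaFeasible_of_feasibleWithoutO2_DNN (ht : 1 ≤ t)
    (h : FeasibleWithoutO2 DNN G t) :
    ∃ X : Matrix V V ℝ, ThetaFeasible DNN G X ∧ t ≤ innerJ X := by
  classical
  obtain ⟨Y, ⟨hYp, hY0⟩, hC1, hC2a, hC2b, hO1⟩ := h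
  have ht' : (0 : ℝ) < t := by exact_mod_cast ht
  obtain ⟨hYs, hYq⟩ := posSemidef_real_iff.1 hYp
  let P : Matrix V V ℝ := Matrix.of fun u v => ∑ i, Y (some (u, i)) (some (v, i))
  let Q : Matrix V V ℝ := Matrix.of fun u v => ∑ i, ∑ j, Y (some (u, i)) (some (v, j))
  have hP : ∀ u v, P u v = ∑ i, Y (some (u, i)) (some (v, i)) := fun _ _ => rfl
  have hQ' : ∀ u v, Q u v = ∑ i, ∑ j, Y (some (u, i)) (some (v, j)) := fun _ _ => rfl
  have hP0 : ∀ u v, 0 ≤ P u v := fun u v => hP u v ▸ sum_nonneg fun i _ => hY0 _ _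
  have hPs : ∀ u v, P u v = P v u := fun u v => by
    rw [hP, hP]
    exact sum_congr rfl fun i _ => hYs _ _
  have hQ : Q.PosSemidef := by
    convert posSemidef_congr_sum hYp
      (fun a u => a.elim (0 : ℝ) fun p => if p.1 = u then 1 else 0) using 1
    ext u v
    simp [Q, Fintype.sum_option, Fintype.sum_prod_type_right]
  have hQP : ∀ u v, P u v ≤ Q u v := fun u v => by
    rw [hP, hQ']
    exact sum_le_sum fun i _ => single_le_sum (f := fun j => Y (some (u, i)) (some (v, j))) (fun j _ => hY0 _ _) (mem_univ i)
  have hQP' : ∀ u v, (u = v ∨ G.Adj u v) → Q u v = P u v := fun u v huv => by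
    rw [hP, hQ']
    exact sum_congr rfl fun i _ => sum_eq_single i (fun j _ hj => hO1 i j hj.symm u v huv) (by simp)
  have hPsum : ∑ u, ∑ v, P u v = t := by
    have : ∑ u, ∑ v, P u v = ∑ i, ∑ u, ∑ v, Y (some (u, i)) (some (v, i)) := by
      simp only [P, Matrix.of_apply]
      rw [sum_comm (s := univ (α := Fin t))]
      exact sum_congr rfl fun u _ => sum_comm
    rw [this]
    simp [hC2b]
  have hQsum : (t : ℝ) * t ≤ ∑ u, ∑ v, Q u v := by
    -- The test vector (−t, 1, …, 1) gives t² − 2t·t + ∑ Q ≥ 0.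
    have h0 := hYq fun a => a.elim (-(t : ℝ)) fun _ => 1
    have e1 : ∑ i, ∑ u, Y none (some (u, i)) = t := by simp [hC2a]
    have e2 : ∑ i, ∑ u, Y (some (u, i)) none = t := by
      rw [← e1]
      exact sum_congr rfl fun i _ => sum_congr rfl fun u _ => hYs _ _
    have e3 : ∑ u, ∑ v, Q u v
        = ∑ i, ∑ u, ∑ j, ∑ v, Y (some (u, i)) (some (v, j)) := by
      simp only [Q, Matrix.of_apply]
      rw [sum_comm (s := univ (α := Fin t))]
      refine sum_congr rfl fun u _ => ?_
      rw [sum_comm]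
      exact sum_congr rfl fun i _ => sum_comm
    simp only [Fintype.sum_option, Fintype.sum_prod_type_right, Option.elim, hC1, mul_one, one_mul,
      sum_add_distrib, ← sum_mul, ← mul_sum, e1, e2, ← e3] at h0
    nlinarith
  have hX : ∀ u v, ((t : ℝ)⁻¹ • (Q + (Matrix.diagonal (fun u => ∑ v, P u v) - P))) u v
      = (t : ℝ)⁻¹ * (Q u v - P u v + Matrix.diagonal (fun u => ∑ v, P u v) u v) := fun u v => by
    simp only [Matrix.smul_apply, Matrix.add_apply, Matrix.sub_apply, smul_eq_mul]
    ring
  refine ⟨(t : ℝ)⁻¹ • (Q + (Matrix.diagonal (fun u => ∑ v, P u v) - P)), ⟨⟨?_, fun u v => ?_⟩,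
    ?_, fun u v huv => ?_⟩, ?_⟩
  · exact (hQ.add (posSemidef_diagonal_rowSum_sub hPs hP0)).smul (inv_nonneg.2 ht'.le)
  · rw [hX]
    refine mul_nonneg (inv_nonneg.2 ht'.le) (add_nonneg (sub_nonneg.2 (hQP u v)) ?_)
    rw [Matrix.diagonal_apply]
    split_ifs
    exacts [sum_nonneg fun v _ => hP0 u v, le_rfl]
  · simp only [Matrix.trace, Matrix.diag_apply, hX, Matrix.diagonal_apply_eq,
      hQP' _ _ (Or.inl rfl), sub_self, zero_add]
    rw [← mul_sum, hPsum, inv_mul_cancel₀ ht'.ne']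
  · rw [hX, hQP' u v (Or.inr huv), Matrix.diagonal_apply_ne _ huv.ne]
    simp
  · have hD : ∑ u, ∑ v, Matrix.diagonal (fun u => ∑ v, P u v) u v = ∑ u, ∑ v, P u v :=
      sum_congr rfl fun u _ => by simp [Matrix.diagonal_apply]
    simp only [innerJ, hX, ← mul_sum, sum_add_distrib, sum_sub_distrib, hD]
    rw [sub_add_cancel, le_inv_mul_iff₀ ht']
    exact hQsum

/-- The row-sum hypothesis makes the rows of B = (X − D)/(s − 1) sum to X_uu, so D − B is a
Laplacian; 2 ≤ t ensures s > 1. -/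
theorem ThetaFeasible.feasibleWithO2 {X : Matrix V V ℝ} (hX : ThetaFeasible DNN G X) {s : ℝ}
    (hrow : ∀ u, ∑ v, X u v = s * X u u) (ht : 2 ≤ t) (hts : t ≤ s) :
    FeasibleWithO2 DNN G t := by
  classical
  have ht2 : (2 : ℝ) ≤ t := by exact_mod_cast ht
  have ht0 : (t : ℝ) ≠ 0 := by positivity
  have hs1 : 0 < s - 1 := by linarith
  have hXs := (posSemidef_real_iff.1 hX.mem.1).1
  let D : Matrix V V ℝ := Matrix.diagonal fun u => X u u
  let B : Matrix V V ℝ := (s - 1)⁻¹ • (X - D)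
  have hBd : ∀ u, B u u = 0 := fun u => by simp [B, D]
  have hBn : ∀ u v, u ≠ v → B u v = (s - 1)⁻¹ * X u v := fun u v h => by
    simp [B, D, Matrix.diagonal_apply_ne _ h]
  have hB0 : ∀ u v, 0 ≤ B u v := fun u v => by
    rcases eq_or_ne u v with rfl | h
    · exact (hBd u).ge
    · rw [hBn u v h]
      exact mul_nonneg (inv_nonneg.2 hs1.le) (hX.mem.2 u v)
  have hBs : ∀ u v, B u v = B v u := fun u v => by
    rcases eq_or_ne u v with rfl | h
    · rfl
    · rw [hBn u v h, hBn v u h.symm, hXs]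
  have hBrow : ∀ u, ∑ v, B u v = X u u := fun u => by
    have : ∑ v, D u v = X u u := by simp [D, Matrix.diagonal_apply]
    simp only [B, Matrix.smul_apply, Matrix.sub_apply, smul_eq_mul, ← mul_sum, sum_sub_distrib,
      hrow, this]
    field_simp
  have hXtr : ∑ u, X u u = 1 := hX.trace_eq
  let M : Matrix V V ℝ := D + ((t : ℝ) - 1) • B
  have hM : M.PosSemidef := by
    have : M = (s - 1)⁻¹ • ((s - t) • D + ((t : ℝ) - 1) • X) := by
      ext u v
      simp only [M, B, Matrix.add_apply, Matrix.smul_apply, Matrix.sub_apply, smul_eq_mul]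
      field_simp
      ring
    rw [this]
    refine (Matrix.PosSemidef.add (Matrix.PosSemidef.smul ?_ (by linarith))
      (hX.mem.1.smul (by linarith))).smul (inv_nonneg.2 hs1.le)
    exact Matrix.PosSemidef.diagonal fun u => hX.mem.2 u u
  have hL : (D - B).PosSemidef := by
    have := posSemidef_diagonal_rowSum_sub hBs hB0
    simpa only [hBrow] using this
  -- `R` carries the constant part in [t] together with the border; `S k` carries the kth row of the
  -- projection I − J/t and ignores the border. Summing over k yields weight δ_ij − 1/t on D − B, so
  -- the blocks of `Y` are D for i = j and B otherwise.
  let R : V → Option (V × Fin t) → ℝ := fun u a => a.elim 1 fun p => if u = p.1 then 1 else 0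
  let S : Fin t → V → Option (V × Fin t) → ℝ := fun k u a =>
    a.elim 0 fun p => if u = p.1 then (if k = p.2 then 1 else 0) - (t : ℝ)⁻¹ else 0
  let Y : Matrix (Option (V × Fin t)) (Option (V × Fin t)) ℝ :=
    (t : ℝ)⁻¹ • (Matrix.of fun a b => ∑ u, ∑ v, R u a * M u v * R v b)
      + ∑ k, Matrix.of fun a b => ∑ u, ∑ v, S k u a * (D - B) u v * S k v b
  have hYp : Y.PosSemidef :=
    ((posSemidef_congr_sum hM R).smul (by positivity)).add
      (Matrix.posSemidef_sum _ fun k _ => posSemidef_congr_sum hL (S k))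
  have hMrow : ∀ u, ∑ v, M u v = t * X u u := fun u => by
    have : ∑ v, D u v = X u u := by simp [D, Matrix.diagonal_apply]
    simp only [M, Matrix.add_apply, Matrix.smul_apply, smul_eq_mul, sum_add_distrib, ← mul_sum,
      this, hBrow]
    ring
  have hMs : ∀ u v, M u v = M v u := (posSemidef_real_iff.1 hM).1
  have hY00 : Y none none = 1 := by
    simp only [Y, Matrix.add_apply, Matrix.smul_apply, Matrix.of_apply, Matrix.sum_apply, R, S,
      Option.elim, one_mul, mul_one, zero_mul, mul_zero, sum_const_zero, add_zero, hMrow,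
      ← mul_sum, hXtr, smul_eq_mul]
    exact inv_mul_cancel₀ ht0
  have hY0 : ∀ p, Y none (some p) = X p.1 p.1 := fun p => by
    simp only [Y, Matrix.add_apply, Matrix.smul_apply, Matrix.of_apply, Matrix.sum_apply, R, S,
      Option.elim, one_mul, mul_one, zero_mul, mul_zero, sum_const_zero, add_zero, mul_ite,
      sum_ite_eq', mem_univ, if_true, smul_eq_mul]
    simp only [hMs _ p.1, hMrow]
    field_simp
  have hYY : ∀ p q, Y (some p) (some q) = if p.2 = q.2 then D p.1 q.1 else B p.1 q.1 := by
    intro p q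
    have hδ : ∑ k, ((if k = p.2 then 1 else 0) - (t : ℝ)⁻¹) * ((if k = q.2 then 1 else 0) - (t : ℝ)⁻¹)
        = (if p.2 = q.2 then 1 else 0) - (t : ℝ)⁻¹ := by
      simp only [sub_mul, mul_sub, sum_sub_distrib, ite_mul, mul_ite, one_mul, zero_mul, mul_one,
        mul_zero, sum_ite_eq', mem_univ, if_true, sum_const, card_univ, Fintype.card_fin,
        nsmul_eq_mul, mul_inv_cancel_left₀ ht0, eq_comm (a := q.2)]
      ring
    have e : Y (some p) (some q) = (t : ℝ)⁻¹ * M p.1 q.1 + ∑ k,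
        ((if k = p.2 then 1 else 0) - (t : ℝ)⁻¹) * ((if k = q.2 then 1 else 0) - (t : ℝ)⁻¹)
          * (D - B) p.1 q.1 := by
      simp only [Y, Matrix.add_apply, Matrix.smul_apply, Matrix.of_apply, Matrix.sum_apply, R, S,
        Option.elim, smul_eq_mul]
      congr 1
      · simp
      · refine sum_congr rfl fun k _ => ?_
        rw [sum_eq_single p.1 (fun u _ hu => by simp [hu]) (by simp),
          sum_eq_single q.1 (fun u _ hu => by simp [hu]) (by simp), if_pos rfl, if_pos rfl]
        ring
    rw [e, ← sum_mul, hδ]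
    simp only [M, Matrix.add_apply, Matrix.smul_apply, Matrix.sub_apply, smul_eq_mul]
    split_ifs <;> field_simp <;> ring
  have hDn : ∀ u v, u ≠ v → D u v = 0 := fun u v h => Matrix.diagonal_apply_ne _ h
  have hD0 : ∀ u v, 0 ≤ D u v := fun u v => by
    simp only [D, Matrix.diagonal_apply]
    split_ifs
    exacts [hX.mem.2 u u, le_rfl]
  refine ⟨Y, ⟨hYp, ?_⟩, ⟨hY00, fun i => by simp only [hY0, hXtr], fun i => ?_, ?_⟩, ?_⟩
  · rintro (_ | p) (_ | q)
    · rw [hY00]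
      exact zero_le_one
    · rw [hY0]
      exact hX.mem.2 _ _
    · rw [(posSemidef_real_iff.1 hYp).1, hY0]
      exact hX.mem.2 _ _
    · rw [hYY]
      split_ifs
      exacts [hD0 _ _, hB0 _ _]
  · simp [hYY, D, Matrix.diagonal_apply, hXtr]
  · intro i j hij u v huv
    rw [hYY, if_neg hij]
    rcases huv with rfl | huv
    · exact hBd u
    · rw [hBn u v huv.ne, hX.edge u v huv, mul_zero]
  · intro i u v huv
    rw [hYY, if_pos rfl]
    exact hDn u v huv

theorem feasibleWithO2_DNN_of_CP (h : FeasibleWithO2 CP G t) : FeasibleWithO2 DNN G t :=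
  h.imp fun _ hY => ⟨CP_subset_DNN _ hY.1, hY.2⟩

theorem FeasibleWithO2.feasibleWithoutO2 {K : ConeFamily.{u}} (h : FeasibleWithO2 K G t) :
    FeasibleWithoutO2 K G t :=
  h.imp fun _ hY => ⟨hY.1, hY.2.1⟩

theorem feasibleWithO2_DNN_of_le_thetaPrime [Nonempty V] (h : (t : ℝ) ≤ thetaPrime G) :
    FeasibleWithO2 DNN G t := by
  rcases le_or_gt 2 t with ht | ht
  · obtain ⟨X, hX, hJ⟩ := (isGreatest_thetaPrime G).1
    exact hX.feasibleWithO2 (hX.rowSum_eq hJ) ht h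
  -- For t ≤ 1 the construction could divide by s − 1 = 0, but any constant sequence is stable.
  · have hs : IsStableSeq G fun _ : Fin t => Classical.arbitrary V := fun i j hij =>
      (hij (Fin.ext (by omega))).elim
    exact feasibleWithO2_DNN_of_CP hs.feasibleWithO2_CP

theorem le_thetaPrime_of_feasibleWithoutO2 (ht : 1 ≤ t) (h : FeasibleWithoutO2 DNN G t) :
    (t : ℝ) ≤ thetaPrime G := by
  obtain ⟨X, hX, hle⟩ := exists_thetaFeasible_of_feasibleWithoutO2_DNN ht h
  exact hle.trans hX.innerJ_le_thetaPrime

theorem feasibleWithO2_floor_thetaPrime (G : SimpleGraph V) :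
    FeasibleWithO2 DNN G ⌊thetaPrime G⌋₊ := by
  rcases Nat.eq_zero_or_pos ⌊thetaPrime G⌋₊ with h | h
  · rw [h]
    exact feasibleWithO2_DNN_of_CP
      (IsStableSeq.feasibleWithO2_CP (s := Fin.elim0) fun i => i.elim0)
  · have h1 : (1 : ℝ) ≤ thetaPrime G := by
      simpa using (Nat.le_floor_iff' one_ne_zero).1 h
    cases isEmpty_or_nonempty V
    · rw [thetaPrime_eq_zero] at h1
      norm_num at h1
    · exact feasibleWithO2_DNN_of_le_thetaPrime (Nat.floor_le (by linarith))

theorem le_floor_thetaPrime (h : FeasibleWithoutO2 DNN G t) : t ≤ ⌊thetaPrime G⌋₊ := by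
  rcases Nat.eq_zero_or_pos t with rfl | ht
  · exact Nat.zero_le _
  · exact Nat.le_floor (le_thetaPrime_of_feasibleWithoutO2 ht h)

/-- Mixing with a feasible point of value 1 reaches every intermediate value, which is how the exact
floor in the equivalence is obtained. -/
theorem ThetaFeasible.exists_innerJ_eq {X : Matrix V V ℝ} (hX : ThetaFeasible DNN G X) {r : ℝ}
    (hr : 1 ≤ r) (hle : r ≤ innerJ X) :
    ∃ Z : Matrix V V ℝ, ThetaFeasible DNN G Z ∧ innerJ Z = r := by
  have : Nonempty V := by
    by_contra h
    rw [not_nonempty_iff] at h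
    have := hX.trace_eq
    simp [Matrix.trace] at this
  rcases hle.eq_or_lt with h | hlt
  · exact ⟨X, hX, h.symm⟩
  obtain ⟨E, hE, hE1⟩ := exists_thetaFeasible_innerJ_eq_one G
  have hpos : 0 < innerJ X - 1 := by linarith
  set a := (r - 1) / (innerJ X - 1) with ha
  have ha0 : 0 ≤ a := div_nonneg (by linarith) hpos.le
  have ha1 : a ≤ 1 := (div_le_one hpos).2 (by linarith)
  refine ⟨a • X + (1 - a) • E, ⟨convex_DNN V hX.mem hE.mem ha0 (by linarith) (by ring), ?_, ?_⟩, ?_⟩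
  · simp [Matrix.trace_add, Matrix.trace_smul, hX.trace_eq, hE.trace_eq]
  · intro u v huv
    simp [hX.edge u v huv, hE.edge u v huv]
  · have : innerJ (a • X + (1 - a) • E) = a * innerJ X + (1 - a) * innerJ E := by
      simp only [innerJ, Matrix.add_apply, Matrix.smul_apply, smul_eq_mul, sum_add_distrib, mul_sum]
    rw [this, hE1]
    have : a * (innerJ X - 1) = r - 1 := div_mul_cancel₀ _ hpos.ne'
    linarith

/-- The block part of Y, scaled by t⁻¹, is feasible for `graphG G t`: its edges are exactly the
zeros imposed by O1 and O2, and O2 turns C2b into a trace condition. The test vector (−t, 1, …, 1)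
bounds the objective. -/
theorem le_thetaPrime_graphG (ht : 1 ≤ t) (h : FeasibleWithO2 DNN G t) :
    (t : ℝ) ≤ thetaPrime (graphG G t) := by
  obtain ⟨Y, ⟨hYp, hY0⟩, ⟨hC1, hC2a, hC2b, hO1⟩, hO2⟩ := h
  have ht' : (0 : ℝ) < t := by exact_mod_cast ht
  have hYq := (posSemidef_real_iff.1 hYp).2
  have hYs := (posSemidef_real_iff.1 hYp).1
  have hfeas : ThetaFeasible DNN (graphG G t) ((t : ℝ)⁻¹ • Y.submatrix some some) := by
    refine ⟨⟨(hYp.submatrix some).smul (inv_nonneg.2 ht'.le), fun p q =>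
      mul_nonneg (inv_nonneg.2 ht'.le) (hY0 _ _)⟩, ?_, ?_⟩
    · have : ∀ i, ∑ u, Y (some (u, i)) (some (u, i)) = 1 := fun i => by
        rw [← hC2b i]
        exact sum_congr rfl fun u _ =>
          (sum_eq_single u (fun v _ hv => hO2 i u v hv.symm) (by simp)).symm
      rw [Matrix.trace_smul, Matrix.trace, Fintype.sum_prod_type_right]
      simp [this, ht'.ne']
    · rintro ⟨u, i⟩ ⟨v, j⟩ (⟨hij, huv⟩ | ⟨hij, huv⟩)
      · simp [hO1 i j hij u v huv]
      · obtain rfl : i = j := hij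
        simp [hO2 i u v huv]
  refine le_trans ?_ hfeas.innerJ_le_thetaPrime
  have h0 := hYq fun a => a.elim (-(t : ℝ)) fun _ => 1
  have e1 : ∑ i, ∑ u, Y none (some (u, i)) = t := by simp [hC2a]
  have e2 : ∑ i, ∑ u, Y (some (u, i)) none = t := by
    rw [← e1]
    exact sum_congr rfl fun i _ => sum_congr rfl fun u _ => hYs _ _
  simp only [innerJ, Matrix.smul_apply, Matrix.submatrix_apply, smul_eq_mul, ← mul_sum,
    Fintype.sum_prod_type_right]
  rw [le_inv_mul_iff₀ ht']
  simp only [Fintype.sum_option, Fintype.sum_prod_type_right, Option.elim, hC1, mul_one, one_mul,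
    sum_add_distrib, ← sum_mul, ← mul_sum, e1, e2] at h0
  nlinarith

end DoublyNonnegative

theorem corollary4p5 {V : Type u} [Fintype V] (G : SimpleGraph V) :
    -- `K = DNN`: the largest feasible `t` is `⌊ϑ'(G)⌋`, with or without the condition O2;
    -- the maximum defining `ϑ'(G)` is attained
    ((Nonempty V → IsGreatest (thetaValues DNN G) (thetaPrime G)) ∧
      IsGreatest {t : ℕ | FeasibleWithO2 DNN G t} ⌊thetaPrime G⌋₊ ∧
      IsGreatest {t : ℕ | FeasibleWithoutO2 DNN G t} ⌊thetaPrime G⌋₊) ∧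
    -- `K = CP`: the largest feasible `t` is `α(G)`, with or without the condition O2
    (IsGreatest {t : ℕ | FeasibleWithO2 CP G t} G.indepNum ∧
      IsGreatest {t : ℕ | FeasibleWithoutO2 CP G t} G.indepNum) ∧
    -- for each single `t ≥ 1`, the equivalence of the three programs
    (∀ K : ConeFamily.{u}, (K = DNN ∨ K = CP) → ∀ t : ℕ, 1 ≤ t →
      List.TFAE [
        ∃ X : Matrix V V ℝ, ThetaFeasible K G X ∧ ⌊innerJ X⌋ = (t : ℤ),
        FeasibleWithO2 K G t,
        FeasibleWithoutO2 K G t]) ∧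
    -- `ϑ'(G) ≥ t` implies `ϑ'(G_t) ≥ t`
    (∀ t : ℕ, 1 ≤ t → (t : ℝ) ≤ thetaPrime G → (t : ℝ) ≤ thetaPrime (graphG G t)) := by
  refine ⟨⟨fun _ => isGreatest_thetaPrime G,
    ⟨feasibleWithO2_floor_thetaPrime G, fun t h => le_floor_thetaPrime h.feasibleWithoutO2⟩,
    ⟨(feasibleWithO2_floor_thetaPrime G).feasibleWithoutO2, fun t h => le_floor_thetaPrime h⟩⟩,
    ?_, ?_, ?_⟩
  · obtain ⟨s, hs⟩ := exists_isStableSeq_iff (G := G).2 le_rfl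
    have hub : ∀ t, FeasibleWithoutO2 CP G t → t ≤ G.indepNum := fun t h =>
      exists_isStableSeq_iff.1 (exists_isStableSeq_of_feasibleWithoutO2_CP h)
    exact ⟨⟨hs.feasibleWithO2_CP, fun t h => hub t h.feasibleWithoutO2⟩,
      ⟨hs.feasibleWithO2_CP.feasibleWithoutO2, hub⟩⟩
  · rintro K (rfl | rfl) t ht
    · tfae_have 1 → 2 := by
        rintro ⟨X, hX, hfl⟩
        have hle : (t : ℝ) ≤ innerJ X := by
          have := Int.floor_le (innerJ X)
          rw [hfl] at this
          exact_mod_cast this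
        have : Nonempty V := by
          by_contra h
          rw [not_nonempty_iff] at h
          have := hX.trace_eq
          simp [Matrix.trace] at this
        exact feasibleWithO2_DNN_of_le_thetaPrime (hle.trans hX.innerJ_le_thetaPrime)
      tfae_have 2 → 3 := FeasibleWithO2.feasibleWithoutO2
      tfae_have 3 → 1 := by
        intro h
        obtain ⟨X, hX, hle⟩ := exists_thetaFeasible_of_feasibleWithoutO2_DNN ht h
        obtain ⟨Z, hZ, hZt⟩ := hX.exists_innerJ_eq (by exact_mod_cast ht) hle
        exact ⟨Z, hZ, by rw [hZt, Int.floor_natCast]⟩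
      tfae_finish
    · tfae_have 1 → 2 := by
        rintro ⟨X, hX, hfl⟩
        have hle : (t : ℝ) ≤ innerJ X := by
          have := Int.floor_le (innerJ X)
          rw [hfl] at this
          exact_mod_cast this
        obtain ⟨s, hs⟩ := exists_isStableSeq_iff (G := G) (t := t) |>.2
          (by exact_mod_cast hle.trans (innerJ_le_indepNum hX))
        exact hs.feasibleWithO2_CP
      tfae_have 2 → 3 := FeasibleWithO2.feasibleWithoutO2
      tfae_have 3 → 1 := by
        intro h
        obtain ⟨s, hs⟩ := exists_isStableSeq_of_feasibleWithoutO2_CP h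
        obtain ⟨X, hX, hXt⟩ := hs.exists_thetaFeasible_CP ht
        exact ⟨X, hX, by rw [hXt, Int.floor_natCast]⟩
      tfae_finish
  · intro t ht h
    have : Nonempty V := by
      by_contra hV
      rw [not_nonempty_iff] at hV
      rw [thetaPrime_eq_zero] at h
      have : (1 : ℝ) ≤ t := by exact_mod_cast ht
      linarith
    exact le_thetaPrime_graphG ht (feasibleWithO2_DNN_of_le_thetaPrime h)
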